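/- A (real) left-symmetric algebra (LSA) is a real vector space $A$ with a bilinear product whose associator $(xy)z-x(yz)$ is symmetric in $x,y$. Write $L(a)b=ab$, $R(a)b=ba$ for the left and right multiplications, $P(x)=\det(I+R(x))$ for the characteristic polynomial, and $\tau(x,y)=\operatorname{tr}R(x)R(y)$ for the trace-form of a finite-dimensional LSA. A right principal idempotent is an idempotent $r$ with $\operatorname{tr}R(x)=\tau(r,x)$ for all $x$; there is at most one if $\tau$ is nondegenerate. Fix a nonzero parallel volume form $\Psi$ on $A$, and for smooth $F$ on $A$ let $\mathcal H(F)=\det\big(\partial^2F/\partial x^i\partial x^j\big)$ in linear coordinates $x^1,\dots,x^n$ with $\Psi=dx^1\wedge\dots\wedge dx^n$. **Theorem.** Let $A$ be an $n$-dimensional LSA with characteristic polynomial $P$. Suppose there are $0\neq v\in A$ and $\alpha\in\mathbb R$ with $P(x+tv)=P(x)+\alpha t$ for all $x\in A$, $t\in\mathbb R$, and that $2\operatorname{tr}L(x)=(n+1)\operatorname{tr}R(x)$ for all $x\in A$. Then there is a constant $\kappa\in\mathbb R$ with $\mathcal H(e^P)=\kappa e^{nP}$ on $A$. If, moreover, $\tau$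 is nondegenerate, then: 1. $\kappa\neq0$, and for every $s\in\mathbb R$ the level set $\{P=s\}$ is a (connected) improper affine sphere, whose equiaffine normal is a constant nonzero multiple of $v$; 2. $\alpha\neq0$, the element $r=\alpha^{-1}v$ is the right principal idempotent of $A$, and $\operatorname{tr}R(r)=1$. Here an equiaffine normal of a smooth hypersurface $M$ is a smooth transverse field $\xi$ such that, writing $D_XY=\nabla_XY+h(X,Y)\xi$ and $D_X\xi=-S(X)+\theta(X)\xi$ for the flat connection $D$, tangent $X,Y$, and tangent $\nabla_XY$, $S(X)$, the form $h$ is nondegenerate, $\theta=0$, and $\Psi(\xi,X_1,\dots,X_{n-1})^2=|\det h(X_i,X_j)|$ for all tangent $X_1,\dots,X_{n-1}$ (it is unique up to sign on connected $M$). A connected $M$ is an improper affine sphere if it has an equiaffine normal whose shape operator $S$ vanishes. -/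

import Mathlib

open scoped ContDiff Topology

noncomputable section

/-! ### Left-symmetric algebras

A left-symmetric algebra (LSA) is a left pre-Lie algebra: its associator is symmetric in the first
two arguments.  Equivalently `[a, b] = a * b - b * a` is a Lie bracket and left multiplication is a
representation of it. -/

section LSA

variable (A : Type*) [LeftPreLieRing A] [LeftPreLieAlgebra ℝ A]

/-- The left regular map `L`, with `L a b = a * b`. -/
def lsaLeft : A →ₗ[ℝ] Module.End ℝ A := LinearMap.mul ℝ A

/-- The right regular map `R`, with `R a b = b * a`. -/
def lsaRight : A →ₗ[ℝ] Module.End ℝ A := (LinearMap.mul ℝ A).flip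

/-- The characteristic polynomial `P x = det (I + R x)`. -/
def lsaCharPoly (x : A) : ℝ := LinearMap.det (1 + lsaRight A x)

/-- The linear form `tr R`. -/
def lsaTraceRight : A →ₗ[ℝ] ℝ := LinearMap.trace ℝ A ∘ₗ lsaRight A

/-- The linear form `tr L`. -/
def lsaTraceLeft : A →ₗ[ℝ] ℝ := LinearMap.trace ℝ A ∘ₗ lsaLeft A

/-- The trace-form `τ (x, y) = tr (R x ∘ R y)`. -/
def lsaTraceForm : LinearMap.BilinForm ℝ A :=
  ((LinearMap.mul ℝ (Module.End ℝ A)).compl₁₂ (lsaRight A) (lsaRight A)).compr₂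
    (LinearMap.trace ℝ A)

/-- `r` is the right principal idempotent: it is idempotent and `tr R x = τ (r, x)` for all `x`
(when `τ` is nondegenerate there is at most one such `r`). -/
def IsRightPrincipalIdempotent (r : A) : Prop :=
  r * r = r ∧ ∀ x : A, lsaTraceRight A x = lsaTraceForm A r x

end LSA

/-- The Hessian determinant `det (∂²F / ∂xⁱ ∂xʲ)` in the coordinates of `ℝⁿ`. -/
def hessianDet {n : ℕ} (F : (Fin n → ℝ) → ℝ) (x : Fin n → ℝ) : ℝ :=
  Matrix.det (Matrix.of fun i j : Fin n =>
    fderiv ℝ (fderiv ℝ F) x (Pi.single i 1) (Pi.single j 1))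

/-! ### Equiaffine geometry of hypersurfaces -/

section Hypersurface

variable {E : Type*} [NormedAddCommGroup E] [NormedSpace ℝ E]

/-- `M` is a smooth (embedded) hypersurface: near each of its points it is the zero set of a smooth
function whose differential there is nonzero. -/
def IsSmoothHypersurface (M : Set E) : Prop :=
  ∀ p ∈ M, ∃ (U : Set E) (F : E → ℝ), IsOpen U ∧ p ∈ U ∧ ContDiffOn ℝ ∞ F U ∧
    fderiv ℝ F p ≠ 0 ∧ M ∩ U = {x ∈ U | F x = 0}

/-- The vectors tangent to `M` at `p`: velocities at time `0` of smooth curves in `M`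
through `p`. -/
def tangentVectors (M : Set E) (p : E) : Set E :=
  {X | ∃ γ : ℝ → E, ContDiffAt ℝ ∞ γ 0 ∧ γ 0 = p ∧ (∀ᶠ t in 𝓝 (0 : ℝ), γ t ∈ M) ∧
    deriv γ 0 = X}

/-- `ξ` is a smooth vector field on a neighborhood of `M` that is transverse to `M`. -/
def IsTransversal (M : Set E) (ξ : E → E) : Prop :=
  (∃ U : Set E, IsOpen U ∧ M ⊆ U ∧ ContDiffOn ℝ ∞ ξ U) ∧ ∀ p ∈ M, ξ p ∉ tangentVectors M p

/-- `h`, `S` and `τ` are the second fundamental form, the shape operator and the connection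
one-form of `M` determined by the transversal `ξ` and the flat connection `D` of the ambient space:
along `M`, for tangent `X` and tangent vector fields `Y`,
`D_X Y = ∇_X Y + h (X, Y) ξ` and `D_X ξ = - S X + τ (X) ξ`, with `∇_X Y` and `S X` tangent.
Only the values of `h p`, `S p`, `τ p` on vectors tangent at `p ∈ M` matter. -/
structure IsInducedBy (M : Set E) (ξ : E → E) (h : E → E → E → ℝ) (S : E → E → E)
    (τ : E → E → ℝ) : Prop where
  gauss : ∀ p ∈ M, ∀ X ∈ tangentVectors M p, ∀ Y : E → E, ContDiffAt ℝ ∞ Y p →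
    (∀ᶠ q in 𝓝[M] p, Y q ∈ tangentVectors M q) →
    fderiv ℝ Y p X - h p X (Y p) • ξ p ∈ tangentVectors M p
  shape_tangent : ∀ p ∈ M, ∀ X ∈ tangentVectors M p, S p X ∈ tangentVectors M p
  weingarten : ∀ p ∈ M, ∀ X ∈ tangentVectors M p, fderiv ℝ ξ p X = - S p X + τ p X • ξ p

/-- The second fundamental form `h` is nondegenerate on each tangent space of `M`. -/
def IsNondegenerateOn (M : Set E) (h : E → E → E → ℝ) : Prop :=
  ∀ p ∈ M, ∀ X ∈ tangentVectors M p, (∀ Y ∈ tangentVectors M p, h p X Y = 0) → X = 0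

/-- The volume form induced on `M` by the ambient volume form `Ψ` and the transversal `ξ` is, up to
sign, the volume form of `h`.  That is, `Ψ (ξ, X₁, …, Xₘ) ^ 2 = |det h (X_i, X_j)|` for all tangent
`X₁, …, Xₘ`; the slot of `Ψ` that holds `ξ` is `i₀`, and the others hold the tangent vectors. -/
def IsVolumeNormalized {n : ℕ} (Ψ : E [⋀^Fin n]→ₗ[ℝ] ℝ) (M : Set E) (ξ : E → E)
    (h : E → E → E → ℝ) : Prop :=
  ∀ p ∈ M, ∀ (i₀ : Fin n) (X : Fin n → E), X i₀ = ξ p →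
    (∀ i, i ≠ i₀ → X i ∈ tangentVectors M p) →
    Ψ X ^ 2 = |Matrix.det (Matrix.of fun i j : {i : Fin n // i ≠ i₀} => h p (X i) (X j))|

/-- `ξ` is an equiaffine normal field of the nondegenerate hypersurface `M` with respect to the
parallel volume form `Ψ`, with equiaffine metric `h` and affine shape operator `S`: the connection
one-form of `ξ` vanishes and the volume forms induced by `ξ` and by `h` agree up to sign. -/
structure IsEquiaffineNormalWith {n : ℕ} (Ψ : E [⋀^Fin n]→ₗ[ℝ] ℝ) (M : Set E) (ξ : E → E)
    (h : E → E → E → ℝ) (S : E → E → E) : Prop where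
  transversal : IsTransversal M ξ
  induced : IsInducedBy M ξ h S (fun _ _ => 0)
  nondegenerate : IsNondegenerateOn M h
  volume : IsVolumeNormalized Ψ M ξ h

/-- `ξ` is an equiaffine normal field of `M`. -/
def IsEquiaffineNormal {n : ℕ} (Ψ : E [⋀^Fin n]→ₗ[ℝ] ℝ) (M : Set E) (ξ : E → E) : Prop :=
  ∃ h S, IsEquiaffineNormalWith Ψ M ξ h S

/-- `M` is a connected affine sphere with affine mean curvature `H`: a connected nondegenerate
hypersurface whose affine shape operator is `H` times the identity. -/
def IsAffineSphere {n : ℕ} (Ψ : E [⋀^Fin n]→ₗ[ℝ] ℝ) (M : Set E) (H : ℝ) : Prop :=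
  IsSmoothHypersurface M ∧ IsConnected M ∧
    ∃ ξ h S, IsEquiaffineNormalWith Ψ M ξ h S ∧
      ∀ p ∈ M, ∀ X ∈ tangentVectors M p, S p X = H • X

/-- `M` is a connected improper affine sphere: its affine mean curvature vanishes. -/
def IsImproperAffineSphere {n : ℕ} (Ψ : E [⋀^Fin n]→ₗ[ℝ] ℝ) (M : Set E) : Prop :=
  IsAffineSphere Ψ M 0

end Hypersurface

end

/-! Left-symmetry reads `R(ax) = R(x)R(a) + [L(a), R(x)]`, so along the affine field `x ↦ a + ax`
the endomorphism `I + R(x)` changes by `(I + R(x))R(a)` plus a commutator with `I + R(x)`. By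
Jacobi's formula `P` is a relative invariant: `dP(a + ax) = tr R(a) · P` (`fderiv_charPolyCoord`).

Let `N = D²P + dP ⊗ dP`, so that `D²(e^P) = e^P N` and `κ` has to be `det N`. Translation by `v`
gives `dP(v) = α` and `D²P(·, v) = 0`, hence `Nv = α dP`. If `α = 0`, then `det N = 0`. Otherwise
`adj(N)` takes the value `det N` on `(dP, dP)`, and the derivative of `det N` along the field is
`((n+1) tr R(a) - 2 tr L(a)) det N = 0`. The fields span wherever `P ≠ 0`, in particular near `0`,
and analyticity makes `det N` constant (`expHessDet_eq_const`).

At the origin `D²P = tr R ⊗ tr R - τ`. This identifies `α⁻¹v` with the element representing `tr R`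
and shows `κ ≠ 0` when `τ` is nondegenerate. Each level set is then a graph along `v`, and the
normal is `cv` with `|cα|^(n+1) = |κ|`. -/

open scoped ContDiff Topology

noncomputable section

/-! ### Jacobi's formula and second derivatives -/

section Calculus

variable {E : Type*} [NormedAddCommGroup E] [NormedSpace ℝ E]

/-- Jacobi's formula for the derivative of a determinant. -/
theorem hasFDerivAt_det_apply {ι : Type*} [Fintype ι] [DecidableEq ι] {M : E → Matrix ι ι ℝ}
    {M' : ι → ι → E →L[ℝ] ℝ} {x : E} (hM : ∀ i j, HasFDerivAt (fun y => M y i j) (M' i j) x)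
    (w : E) :
    DifferentiableAt ℝ (fun y => (M y).det) x ∧ fderiv ℝ (fun y => (M y).det) x w =
      ((M x).adjugate * Matrix.of fun i j => M' i j w).trace := by
  let D : ContinuousMultilinearMap ℝ (fun _ : ι => ι → ℝ) ℝ :=
    { (Matrix.detRowAlternating (n := ι) (R := ℝ)).toMultilinearMap with
      cont := by
        change Continuous fun A : Matrix ι ι ℝ => A.det
        exact continuous_id.matrix_det }
  have hM2 : HasFDerivAt (fun y => (M y : ι → ι → ℝ))
      (ContinuousLinearMap.pi fun i => ContinuousLinearMap.pi fun j => M' i j) x :=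
    hasFDerivAt_pi.2 fun i => hasFDerivAt_pi.2 fun j => hM i j
  have h := (D.hasFDerivAt (x := M x)).comp x hM2
  have h' : HasFDerivAt (fun y => (M y).det) _ x := h
  refine ⟨h'.differentiableAt, ?_⟩
  rw [h'.fderiv]
  refine (D.linearDeriv_apply (M x) (fun i j => M' i j w)).trans ?_
  rw [Matrix.trace_mul_comm]
  simp only [Matrix.trace, Matrix.diag, Matrix.mul_apply, Matrix.of_apply]
  refine Finset.sum_congr rfl fun i _ => ?_
  -- Multilinearity in the rows leaves determinants with one row replaced; Cramer's rule expresses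
  -- them through the adjugate.
  change ((M x).updateRow i fun j => M' i j w).det = _
  rw [← Matrix.cramer_transpose_apply, Matrix.cramer_eq_adjugate_mulVec,
    ← Matrix.adjugate_transpose]
  simp [Matrix.mulVec, dotProduct, mul_comm]

theorem fderiv_fderiv_apply {g : E → ℝ} (hg : ContDiff ℝ ω g) (x y z : E) :
    fderiv ℝ (fun u => fderiv ℝ g u z) x y = fderiv ℝ (fderiv ℝ g) x y z := by
  have h : DifferentiableAt ℝ (fderiv ℝ g) x :=
    (hg.fderiv_right (m := ω) (by simp)).differentiable (by simp) x
  rw [fderiv_clm_apply h (differentiableAt_const z)]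
  simp

theorem fderiv_fderiv_comm {g : E → ℝ} (hg : ContDiff ℝ ω g) (x y z : E) :
    fderiv ℝ (fderiv ℝ g) x y z = fderiv ℝ (fderiv ℝ g) x z y :=
  hg.contDiffAt.isSymmSndFDerivAt_of_omega y z

theorem contDiff_fderiv_apply {g : E → ℝ} (hg : ContDiff ℝ ω g) (z : E) :
    ContDiff ℝ ω (fun u => fderiv ℝ g u z) :=
  (hg.fderiv_right (m := ω) (by simp)).clm_apply contDiff_const

/-- Differentiating an identity `dg (a + L x) = k`, where `x ↦ a + L x` is an affine field. -/
theorem fderiv_fderiv_apply_affine {g k : E → ℝ} (hg : ContDiff ℝ ω g) (a : E) (L : E →L[ℝ] E)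
    (h : ∀ x, fderiv ℝ g x (a + L x) = k x) (x z : E) :
    fderiv ℝ (fun u => fderiv ℝ g u z) x (a + L x) = fderiv ℝ k x z - fderiv ℝ g x (L z) := by
  have hd : DifferentiableAt ℝ (fderiv ℝ g) x :=
    (hg.fderiv_right (m := ω) (by simp)).differentiable (by simp) x
  have hk : k = fun x => fderiv ℝ g x (a + L x) := funext fun x => (h x).symm
  have hw : HasFDerivAt (fun x => a + L x) L x := L.hasFDerivAt.const_add a
  rw [fderiv_fderiv_apply hg, hk, fderiv_clm_apply hd hw.differentiableAt, hw.fderiv,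
    fderiv_fderiv_comm hg]
  simp

/-- The symmetric bilinear form `D²f + df ⊗ df`, which is `e⁻ᶠ D²(eᶠ)`. -/
def expHessForm (f : E → ℝ) (x : E) : LinearMap.BilinForm ℝ E :=
  LinearMap.mk₂ ℝ (fun y z => fderiv ℝ (fderiv ℝ f) x y z + fderiv ℝ f x y * fderiv ℝ f x z)
    (by intros; simp; ring) (by intros; simp; ring) (by intros; simp; ring) (by intros; simp; ring)

theorem expHessForm_apply (f : E → ℝ) (x y z : E) :
    expHessForm f x y z = fderiv ℝ (fderiv ℝ f) x y z + fderiv ℝ f x y * fderiv ℝ f x z := rfl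

theorem fderiv_fderiv_exp {f : E → ℝ} (hf : ContDiff ℝ ω f) (x y z : E) :
    fderiv ℝ (fderiv ℝ fun u => Real.exp (f u)) x y z = Real.exp (f x) * expHessForm f x y z := by
  have hF : ContDiff ℝ ω fun u => Real.exp (f u) := Real.contDiff_exp.comp hf
  have hd : ∀ u, HasFDerivAt f (fderiv ℝ f u) u := fun u =>
    (hf.differentiable (by simp) u).hasFDerivAt
  have h2 : (fun u => fderiv ℝ (fun u => Real.exp (f u)) u z) =
      fun u => Real.exp (f u) * fderiv ℝ f u z := by
    funext u
    rw [(hd u).exp.fderiv]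
    simp
  rw [← fderiv_fderiv_apply hF, h2, ((hd x).exp.fun_mul
    ((contDiff_fderiv_apply hf z).differentiable (by simp) x).hasFDerivAt).fderiv,
    expHessForm_apply, ← fderiv_fderiv_apply hf]
  simp
  ring

end Calculus

/-- The determinant of `D²f + df ⊗ df` in the coordinates of `ℝⁿ`. -/
def expHessDet {n : ℕ} (f : (Fin n → ℝ) → ℝ) (x : Fin n → ℝ) : ℝ :=
  (expHessForm f x).toMatrix'.det

theorem hessianDet_exp {n : ℕ} {f : (Fin n → ℝ) → ℝ} (hf : ContDiff ℝ ω f) (x : Fin n → ℝ) :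
    hessianDet (fun u => Real.exp (f u)) x = expHessDet f x * Real.exp (n * f x) := by
  have : (Matrix.of fun i j : Fin n => fderiv ℝ (fderiv ℝ fun u => Real.exp (f u)) x
      (Pi.single i 1) (Pi.single j 1)) = Real.exp (f x) • (expHessForm f x).toMatrix' := by
    ext i j
    rw [Matrix.of_apply, fderiv_fderiv_exp hf]
    simp [LinearMap.BilinForm.toMatrix'_apply]
  rw [hessianDet, this, Matrix.det_smul, expHessDet, Fintype.card_fin, ← Real.exp_nat_mul, mul_comm]

/-! ### Functions shifted by translations along a vector -/

section TranslationEquivariant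

variable {E : Type*} [NormedAddCommGroup E] [NormedSpace ℝ E] {f : E → ℝ} {v : E} {α : ℝ}

theorem fderiv_apply_of_translation (hf : ContDiff ℝ ω f)
    (hv : ∀ (x : E) (s : ℝ), f (x + s • v) = f x + α * s) (x : E) : fderiv ℝ f x v = α := by
  have h1 : HasDerivAt (fun s : ℝ => x + s • v) v 0 := by
    simpa using ((hasDerivAt_id (0 : ℝ)).smul_const v).const_add x
  have h2 : HasFDerivAt f (fderiv ℝ f x) (x + (0 : ℝ) • v) := by
    simpa using (hf.differentiable (by simp) x).hasFDerivAt
  have h3 : HasDerivAt (fun s : ℝ => f (x + s • v)) (fderiv ℝ f x v) 0 :=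
    h2.comp_hasDerivAt 0 h1
  have h4 : HasDerivAt (fun s : ℝ => f (x + s • v)) α 0 := by
    simp only [hv]
    simpa using ((hasDerivAt_id (0 : ℝ)).const_mul α).const_add (f x)
  exact h3.unique h4

theorem fderiv_fderiv_apply_of_translation (hf : ContDiff ℝ ω f)
    (hv : ∀ (x : E) (s : ℝ), f (x + s • v) = f x + α * s) (x y : E) :
    fderiv ℝ (fderiv ℝ f) x y v = 0 := by
  rw [← fderiv_fderiv_apply hf]
  simp [fderiv_apply_of_translation hf hv]

theorem expHessForm_apply_of_translation (hf : ContDiff ℝ ω f)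
    (hv : ∀ (x : E) (s : ℝ), f (x + s • v) = f x + α * s) (x y : E) :
    expHessForm f x y v = fderiv ℝ f x y * α := by
  rw [expHessForm_apply, fderiv_fderiv_apply_of_translation hf hv,
    fderiv_apply_of_translation hf hv, zero_add]

/-- The infinitesimal transformation of `D²f + df ⊗ df` under an affine field of which `f` is a
relative invariant. -/
theorem fderiv_expHessForm_affine (hf : ContDiff ℝ ω f) {a : E} {L : E →L[ℝ] E} {t : ℝ}
    (h : ∀ x, fderiv ℝ f x (a + L x) = t * f x) (x y z : E) :
    fderiv ℝ (fun u => expHessForm f u y z) x (a + L x) =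
      t * (expHessForm f x y z + fderiv ℝ f x y * fderiv ℝ f x z) -
        expHessForm f x (L y) z - expHessForm f x y (L z) := by
  have hd : ∀ z u, HasFDerivAt (fun u => fderiv ℝ f u z)
      (fderiv ℝ (fun u => fderiv ℝ f u z) u) u := fun z u =>
    ((contDiff_fderiv_apply hf z).differentiable (by simp) u).hasFDerivAt
  have hdf : ∀ u, HasFDerivAt f (fderiv ℝ f u) u := fun u =>
    (hf.differentiable (by simp) u).hasFDerivAt
  have h1 : ∀ z u, fderiv ℝ (fun u => fderiv ℝ f u z) u (a + L u) =
      t * fderiv ℝ f u z - fderiv ℝ f u (L z) := fun z u => by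
    rw [fderiv_fderiv_apply_affine hf a L h, ((hdf u).const_mul t).fderiv]
    simp
  -- By `h1`, the function `df(z)` satisfies an identity of the same kind as `f`, so the affine rule
  -- applies a second time.
  have h2 := fderiv_fderiv_apply_affine (contDiff_fderiv_apply hf z) a L (h1 z) x y
  rw [(((hd z x).const_mul t).fun_sub (hd (L z) x)).fderiv] at h2
  have h3 : (fun u => expHessForm f u y z) = fun u =>
      fderiv ℝ (fun u => fderiv ℝ f u z) u y + fderiv ℝ f u y * fderiv ℝ f u z := by
    funext u
    rw [expHessForm_apply, fderiv_fderiv_apply hf]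
  have h4 := ((contDiff_fderiv_apply (contDiff_fderiv_apply hf z) y).differentiable
    (by simp) x).hasFDerivAt
  rw [h3, (h4.fun_add ((hd y x).fun_mul (hd z x))).fderiv]
  simp only [add_apply, sub_apply, smul_apply, h2, h1, smul_eq_mul]
  simp only [expHessForm_apply, fderiv_fderiv_apply hf]
  ring

end TranslationEquivariant

theorem contDiff_expHessForm_apply {E : Type*} [NormedAddCommGroup E] [NormedSpace ℝ E]
    {f : E → ℝ} (hf : ContDiff ℝ ω f) (y z : E) :
    ContDiff ℝ ω (fun u => expHessForm f u y z) := by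
  have h3 : (fun u => expHessForm f u y z) = fun u =>
      fderiv ℝ (fun u => fderiv ℝ f u z) u y + fderiv ℝ f u y * fderiv ℝ f u z := by
    funext u
    rw [expHessForm_apply, fderiv_fderiv_apply hf]
  rw [h3]
  exact (contDiff_fderiv_apply (contDiff_fderiv_apply hf z) y).add
    ((contDiff_fderiv_apply hf y).mul (contDiff_fderiv_apply hf z))

/-! ### Constancy of the determinant -/

section Determinant

variable {n : ℕ} {f : (Fin n → ℝ) → ℝ} {v : Fin n → ℝ} {α : ℝ}

theorem contDiff_expHessDet (hf : ContDiff ℝ ω f) : ContDiff ℝ ω (expHessDet f) := by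
  unfold expHessDet
  simp only [Matrix.det_apply, LinearMap.BilinForm.toMatrix'_apply]
  exact ContDiff.sum fun σ _ => (contDiff_prod fun i _ =>
    contDiff_expHessForm_apply hf _ _).const_smul _

theorem expHessForm_toMatrix'_mulVec (hf : ContDiff ℝ ω f)
    (hv : ∀ (x : Fin n → ℝ) (s : ℝ), f (x + s • v) = f x + α * s) (x : Fin n → ℝ) :
    (expHessForm f x).toMatrix'.mulVec v = α • fun i => fderiv ℝ f x (Pi.single i 1) := by
  ext i
  have h := expHessForm_apply_of_translation hf hv x (Pi.single i 1)
  rw [← LinearMap.BilinForm.toMatrix'.symm_apply_apply (expHessForm f x),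
    LinearMap.BilinForm.toMatrix'_symm, Matrix.toBilin'_apply'] at h
  simpa [mul_comm] using h

theorem expHessDet_eq_zero (hf : ContDiff ℝ ω f) (hv0 : v ≠ 0)
    (hv : ∀ (x : Fin n → ℝ) (s : ℝ), f (x + s • v) = f x + 0 * s) (x : Fin n → ℝ) :
    expHessDet f x = 0 :=
  Matrix.exists_mulVec_eq_zero_iff.1 ⟨v, hv0, by
    rw [expHessForm_toMatrix'_mulVec hf hv, zero_smul]⟩

/-- With `p = df`, the matrix `N` has derivative `t(N + ppᵀ) - ΛᵀN - NΛ` along the field. Pairing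
with `adj(N)` gives `t(n + 1) det N - 2 tr Λ det N`, where the extra `1` comes from `ppᵀ`. -/
theorem fderiv_expHessDet_affine (hf : ContDiff ℝ ω f) (hα : α ≠ 0)
    (hv : ∀ (x : Fin n → ℝ) (s : ℝ), f (x + s • v) = f x + α * s)
    {a : Fin n → ℝ} {L : (Fin n → ℝ) →L[ℝ] (Fin n → ℝ)} {t : ℝ}
    (h : ∀ x, fderiv ℝ f x (a + L x) = t * f x)
    (ht : 2 * LinearMap.trace ℝ _ (L : (Fin n → ℝ) →ₗ[ℝ] (Fin n → ℝ)) = ((n : ℝ) + 1) * t)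
    (x : Fin n → ℝ) : fderiv ℝ (expHessDet f) x (a + L x) = 0 := by
  set N := (expHessForm f x).toMatrix' with hN
  set p : Fin n → ℝ := fun i => fderiv ℝ f x (Pi.single i 1) with hp
  set Λ := LinearMap.toMatrix' (L : (Fin n → ℝ) →ₗ[ℝ] (Fin n → ℝ)) with hΛ
  have hJ := (hasFDerivAt_det_apply (M := fun u => (expHessForm f u).toMatrix') (x := x)
    (M' := fun i j =>
      fderiv ℝ (fun u => expHessForm f u (Pi.single i 1) (Pi.single j 1)) x)
    (fun i j => by
      simp only [LinearMap.BilinForm.toMatrix'_apply]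
      exact ((contDiff_expHessForm_apply hf _ _).differentiable (by simp) x).hasFDerivAt)
    (a + L x)).2
  have hdot : (Matrix.of fun i j =>
      fderiv ℝ (fun u => expHessForm f u (Pi.single i 1) (Pi.single j 1)) x (a + L x)) =
      t • (N + Matrix.vecMulVec p p) - Λ.transpose * N - N * Λ := by
    rw [hΛ, hN, ← LinearMap.BilinForm.toMatrix'_compLeft, ← LinearMap.BilinForm.toMatrix'_compRight]
    ext i j
    rw [Matrix.of_apply, fderiv_expHessForm_affine hf h]
    simp [LinearMap.BilinForm.toMatrix'_apply, Matrix.vecMulVec_apply, hp, mul_add]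
  have hNv : N.mulVec v = α • p := expHessForm_toMatrix'_mulVec hf hv x
  have hpv : p ⬝ᵥ v = α := by
    rw [← fderiv_apply_of_translation hf hv x]
    conv_rhs => rw [pi_eq_sum_univ' v]
    simp [dotProduct, hp, mul_comm]
  -- Since `αp = Nv`, `α adj(N)p · p = adj(N)Nv · p = det N (v · p) = α det N`.
  have hρ : N.adjugate.mulVec p ⬝ᵥ p = N.det := by
    apply mul_left_cancel₀ hα
    rw [← smul_eq_mul, ← smul_dotProduct, ← Matrix.mulVec_smul, ← hNv, Matrix.mulVec_mulVec,
      Matrix.adjugate_mul, Matrix.smul_mulVec, Matrix.one_mulVec, smul_dotProduct,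
      dotProduct_comm, hpv, smul_eq_mul, mul_comm]
  have hΛt : Λ.trace = LinearMap.trace ℝ _ (L : (Fin n → ℝ) →ₗ[ℝ] (Fin n → ℝ)) := by
    rw [LinearMap.trace_eq_matrix_trace ℝ (Pi.basisFun ℝ (Fin n)), LinearMap.toMatrix_eq_toMatrix']
  unfold expHessDet
  rw [hJ, hdot]
  have e1 : (N.adjugate * (Λ.transpose * N)).trace = N.det * Λ.trace := by
    rw [Matrix.trace_mul_comm, Matrix.mul_assoc, Matrix.mul_adjugate]
    simp
  have e2 : (N.adjugate * (N * Λ)).trace = N.det * Λ.trace := by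
    rw [← Matrix.mul_assoc, Matrix.adjugate_mul]
    simp
  have e3 : (N.adjugate * N).trace = N.det * n := by
    rw [Matrix.adjugate_mul]
    simp
  rw [Matrix.mul_sub, Matrix.mul_sub, Matrix.trace_sub, Matrix.trace_sub, e1, e2, Matrix.mul_smul,
    Matrix.trace_smul, Matrix.mul_add, Matrix.trace_add, e3, Matrix.mul_vecMulVec,
    Matrix.trace_vecMulVec, hρ, hΛt, smul_eq_mul]
  linear_combination (-N.det) * ht

theorem expHessDet_eq_const (hf : ContDiff ℝ ω f) (hv0 : v ≠ 0)
    (hv : ∀ (x : Fin n → ℝ) (s : ℝ), f (x + s • v) = f x + α * s)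
    {L : (Fin n → ℝ) → (Fin n → ℝ) →L[ℝ] (Fin n → ℝ)} {t : (Fin n → ℝ) → ℝ}
    (h : ∀ a x, fderiv ℝ f x (a + L a x) = t a * f x)
    (ht : ∀ a, 2 * LinearMap.trace ℝ _ (L a : (Fin n → ℝ) →ₗ[ℝ] (Fin n → ℝ)) =
      ((n : ℝ) + 1) * t a)
    (hs : ∀ᶠ x in 𝓝 (0 : Fin n → ℝ), ∀ y, ∃ a, a + L a x = y) (x : Fin n → ℝ) :
    expHessDet f x = expHessDet f 0 := by
  by_cases hα : α = 0
  · subst hα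
    rw [expHessDet_eq_zero hf hv0 hv, expHessDet_eq_zero hf hv0 hv]
  have hG := contDiff_expHessDet hf
  -- The fields span only near the origin; analyticity carries the vanishing of the differential to
  -- the whole space.
  have h0 : fderiv ℝ (expHessDet f) =ᶠ[𝓝 0] 0 := by
    filter_upwards [hs] with x hx
    ext1 y
    obtain ⟨a, rfl⟩ := hx y
    exact fderiv_expHessDet_affine hf hα hv (h a) (ht a) x
  have h1 : fderiv ℝ (expHessDet f) = 0 :=
    AnalyticOnNhd.eq_of_eventuallyEq
      ((hG.fderiv_right (m := ω) (by simp)).analyticOnNhd (s := Set.univ))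
      (fun _ _ => analyticAt_const) h0
  exact is_const_of_fderiv_eq_zero (hG.differentiable (by simp)) (fun x => congrFun h1 x) x 0

end Determinant

/-! ### Trace identities in a left-symmetric algebra -/

section LSA

variable {A : Type*} [LeftPreLieRing A] [LeftPreLieAlgebra ℝ A]

@[simp] theorem lsaLeft_apply (a x : A) : lsaLeft A a x = a * x := rfl

@[simp] theorem lsaRight_apply (a x : A) : lsaRight A a x = x * a := rfl

theorem lsaTraceRight_apply (a : A) : lsaTraceRight A a = LinearMap.trace ℝ A (lsaRight A a) := rfl

theorem lsaTraceForm_apply (a x : A) :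
    lsaTraceForm A a x = LinearMap.trace ℝ A (lsaRight A a * lsaRight A x) := rfl

theorem lsaRight_mul (a x : A) :
    lsaRight A (a * x) = lsaRight A x * lsaRight A a +
      (lsaLeft A a * lsaRight A x - lsaRight A x * lsaLeft A a) := by
  ext z
  have h := LeftPreLieRing.assoc_symm z a x
  simp only [associator_apply] at h
  simp only [lsaRight_apply, LinearMap.add_apply, LinearMap.sub_apply, Module.End.mul_apply,
    lsaLeft_apply]
  rw [sub_eq_sub_iff_add_eq_add] at h
  rw [← sub_eq_zero] at h ⊢
  rw [← neg_eq_zero, ← h]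
  abel

theorem lsaTraceForm_comm (a x : A) : lsaTraceForm A a x = lsaTraceForm A x a := by
  rw [lsaTraceForm_apply, lsaTraceForm_apply, LinearMap.trace_mul_comm]

theorem lsaTraceRight_mul (a x : A) : lsaTraceRight A (a * x) = lsaTraceForm A a x := by
  rw [lsaTraceRight_apply, lsaRight_mul, map_add, map_sub,
    LinearMap.trace_mul_comm ℝ (lsaLeft A a), sub_self, add_zero, lsaTraceForm_comm,
    lsaTraceForm_apply]

/-- When the trace-form is nondegenerate, an element that represents `tr R` is idempotent. -/
theorem isRightPrincipalIdempotent_of_traceForm (hτ : (lsaTraceForm A).Nondegenerate) {r : A}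
    (hr : ∀ x, lsaTraceRight A x = lsaTraceForm A r x) : IsRightPrincipalIdempotent A r := by
  refine ⟨?_, hr⟩
  rw [← sub_eq_zero]
  refine hτ.2 _ fun x => ?_
  -- Applying `tr R` to the associator identity for `(r, x, r)` turns every term into a value of
  -- `τ`; three of them equal `τ(x, r)`, which leaves `τ(x, rr) = τ(x, r)`.
  have h := congrArg (lsaTraceRight A) (LeftPreLieRing.assoc_symm r x r)
  simp only [associator_apply, map_sub, lsaTraceRight_mul] at h
  rw [lsaTraceForm_comm (r * x), lsaTraceForm_comm (x * r), ← hr, ← hr, lsaTraceRight_mul,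
    lsaTraceRight_mul, lsaTraceForm_comm x r] at h
  rw [map_sub, lsaTraceForm_comm x r]
  linarith

theorem lsaCharPoly_zero : lsaCharPoly A 0 = 1 := by
  simp [lsaCharPoly]

theorem exists_add_mul_eq [FiniteDimensional ℝ A] {x : A} (hx : lsaCharPoly A x ≠ 0) (y : A) : ∃ a, a + a * x = y := by
  have := (Module.End.isUnit_iff _).1 ((LinearMap.isUnit_iff_isUnit_det _).2 hx.isUnit)
  obtain ⟨a, ha⟩ := this.2 y
  exact ⟨a, by simpa using ha⟩

/-! ### The characteristic polynomial in coordinates -/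

variable {n : ℕ} (b : Module.Basis (Fin n) ℝ A)

/-- The characteristic polynomial in the coordinates of a basis. -/
def charPolyCoord (y : Fin n → ℝ) : ℝ := lsaCharPoly A (b.equivFun.symm y)

/-- The left multiplication of the algebra in the coordinates of a basis. -/
def leftCoord (y : Fin n → ℝ) : (Fin n → ℝ) →L[ℝ] (Fin n → ℝ) :=
  LinearMap.toContinuousLinearMap (b.equivFun.conj (lsaLeft A (b.equivFun.symm y)))

theorem leftCoord_apply (y z : Fin n → ℝ) :
    leftCoord b y z = b.equivFun (b.equivFun.symm y * b.equivFun.symm z) := rfl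

theorem trace_leftCoord (y : Fin n → ℝ) :
    LinearMap.trace ℝ _ (leftCoord b y : (Fin n → ℝ) →ₗ[ℝ] (Fin n → ℝ)) =
      lsaTraceLeft A (b.equivFun.symm y) :=
  LinearMap.trace_conj' _ _

/-- An entry of the matrix of a right multiplication, as a linear form. -/
def rightCoord (i j : Fin n) : (Fin n → ℝ) →L[ℝ] ℝ :=
  LinearMap.toContinuousLinearMap
    (Matrix.entryLinearMap ℝ ℝ i j ∘ₗ (LinearMap.toMatrix b b).toLinearMap ∘ₗ lsaRight A ∘ₗ
      b.equivFun.symm.toLinearMap)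

theorem charPolyCoord_eq (y : Fin n → ℝ) :
    charPolyCoord b y =
      (Matrix.of fun i j => (1 : Matrix (Fin n) (Fin n) ℝ) i j + rightCoord b i j y).det := by
  rw [charPolyCoord, lsaCharPoly, ← LinearMap.det_toMatrix b, map_add, LinearMap.toMatrix_one]
  rfl

theorem contDiff_charPolyCoord : ContDiff ℝ ω (charPolyCoord b) := by
  have : charPolyCoord b = fun y => charPolyCoord b y := rfl
  rw [this]
  simp only [charPolyCoord_eq, Matrix.det_apply, Matrix.of_apply]
  exact ContDiff.sum fun σ _ => (contDiff_prod fun i _ =>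
    contDiff_const.add (rightCoord b _ _).contDiff).const_smul _

/-- The characteristic polynomial is a relative invariant of the affine fields `x ↦ a + a x`. -/
theorem fderiv_charPolyCoord (a x : Fin n → ℝ) :
    fderiv ℝ (charPolyCoord b) x (a + leftCoord b a x) =
      lsaTraceRight A (b.equivFun.symm a) * charPolyCoord b x := by
  have hJ := (hasFDerivAt_det_apply
    (M := fun y => Matrix.of fun i j => (1 : Matrix (Fin n) (Fin n) ℝ) i j + rightCoord b i j y)
    (x := x) (M' := rightCoord b)
    (fun i j => (rightCoord b i j).hasFDerivAt.const_add _) (a + leftCoord b a x)).2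
  have hfun : charPolyCoord b = fun y => _ := funext (charPolyCoord_eq b)
  rw [← hfun] at hJ
  rw [hJ]
  set a' := b.equivFun.symm a
  set x' := b.equivFun.symm x
  have hM : (Matrix.of fun i j => (1 : Matrix (Fin n) (Fin n) ℝ) i j + rightCoord b i j x) =
      LinearMap.toMatrix b b (1 + lsaRight A x') := by
    rw [map_add, LinearMap.toMatrix_one]; rfl
  have hR : (Matrix.of fun i j => rightCoord b i j (a + leftCoord b a x)) =
      LinearMap.toMatrix b b ((1 + lsaRight A x') * lsaRight A a' +
        (lsaLeft A a' * (1 + lsaRight A x') - (1 + lsaRight A x') * lsaLeft A a')) := by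
    have : (Matrix.of fun i j => rightCoord b i j (a + leftCoord b a x)) =
      LinearMap.toMatrix b b (lsaRight A (b.equivFun.symm (a + leftCoord b a x))) := rfl
    rw [this, map_add, leftCoord_apply, LinearEquiv.symm_apply_apply, map_add, lsaRight_mul]
    congr 1
    noncomm_ring
  have htr : lsaTraceRight A a' = (LinearMap.toMatrix b b (lsaRight A a')).trace :=
    LinearMap.trace_eq_matrix_trace ℝ b _
  rw [charPolyCoord_eq, hM, hR, htr]
  generalize 1 + lsaRight A x' = T
  rw [map_add, map_sub, LinearMap.toMatrix_mul, LinearMap.toMatrix_mul, LinearMap.toMatrix_mul]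
  generalize LinearMap.toMatrix b b T = M
  -- The commutator with `M` drops out of the trace because `adj(M)M` and `M adj(M)` are both `det M
  -- · I`.
  rw [Matrix.mul_add, Matrix.mul_sub, ← Matrix.mul_assoc, ← Matrix.mul_assoc M.adjugate M,
    Matrix.trace_add, Matrix.trace_sub, ← Matrix.mul_assoc M.adjugate,
    Matrix.trace_mul_cycle M.adjugate _ M, Matrix.mul_adjugate, Matrix.adjugate_mul]
  simp [mul_comm]

theorem charPolyCoord_zero : charPolyCoord b 0 = 1 := by
  rw [charPolyCoord, map_zero, lsaCharPoly_zero]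

theorem fderiv_charPolyCoord_zero (a : Fin n → ℝ) :
    fderiv ℝ (charPolyCoord b) 0 a = lsaTraceRight A (b.equivFun.symm a) := by
  simpa [charPolyCoord_zero] using fderiv_charPolyCoord b a 0

/-- Differentiating the relative invariance at the origin produces the term `tr R(az)`, which is
`τ(a, z)`. -/
theorem fderiv_fderiv_charPolyCoord_zero (a z : Fin n → ℝ) :
    fderiv ℝ (fderiv ℝ (charPolyCoord b)) 0 a z =
      lsaTraceRight A (b.equivFun.symm a) * lsaTraceRight A (b.equivFun.symm z) -
        lsaTraceForm A (b.equivFun.symm a) (b.equivFun.symm z) := by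
  have h := fderiv_fderiv_apply_affine (contDiff_charPolyCoord b) a (leftCoord b a)
    (fderiv_charPolyCoord b a) 0 z
  rw [fderiv_fderiv_apply (contDiff_charPolyCoord b), (((contDiff_charPolyCoord b).differentiable
    (by simp) 0).hasFDerivAt.const_mul _).fderiv, map_zero, add_zero, smul_apply,
    fderiv_charPolyCoord_zero, fderiv_charPolyCoord_zero, leftCoord_apply,
    LinearEquiv.symm_apply_apply, lsaTraceRight_mul] at h
  exact h

theorem expHessDet_charPolyCoord {v : A} (hv : v ≠ 0) {α : ℝ}
    (hP : ∀ (x : A) (t : ℝ), lsaCharPoly A (x + t • v) = lsaCharPoly A x + α * t)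
    (hLR : ∀ x : A, 2 * lsaTraceLeft A x = ((n : ℝ) + 1) * lsaTraceRight A x) (x : Fin n → ℝ) :
    expHessDet (charPolyCoord b) x = expHessDet (charPolyCoord b) 0 := by
  refine expHessDet_eq_const (v := b.equivFun v) (α := α) (contDiff_charPolyCoord b) (by simpa)
    (fun x s => by simp [charPolyCoord, map_add, hP]) (fderiv_charPolyCoord b)
    (fun a => by rw [trace_leftCoord, hLR]) ?_ x
  have h0 : ∀ᶠ x in 𝓝 (0 : Fin n → ℝ), charPolyCoord b x ≠ 0 :=
    (contDiff_charPolyCoord b).continuous.continuousAt.eventually_ne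
      (by rw [charPolyCoord_zero]; exact one_ne_zero)
  have := b.finiteDimensional_of_finite
  filter_upwards [h0] with x hx y
  obtain ⟨a, ha⟩ := exists_add_mul_eq hx (b.equivFun.symm y)
  refine ⟨b.equivFun a, ?_⟩
  rw [leftCoord_apply, LinearEquiv.symm_apply_apply, ← map_add, ha, LinearEquiv.apply_symm_apply]

theorem lsaTraceForm_apply_of_translation {n : ℕ} (b : Module.Basis (Fin n) ℝ A) {v : A} {α : ℝ}
    (hP : ∀ (x : A) (t : ℝ), lsaCharPoly A (x + t • v) = lsaCharPoly A x + α * t) (x : A) :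
    lsaTraceRight A v = α ∧ lsaTraceForm A v x = α * lsaTraceRight A x := by
  have hP' : ∀ (x : Fin n → ℝ) (s : ℝ),
      charPolyCoord b (x + s • b.equivFun v) = charPolyCoord b x + α * s :=
    fun x s => by simp [charPolyCoord, map_add, hP]
  have h1 := fderiv_apply_of_translation (contDiff_charPolyCoord b) hP' 0
  have h2 := fderiv_fderiv_apply_of_translation (contDiff_charPolyCoord b) hP' 0 (b.equivFun x)
  rw [fderiv_charPolyCoord_zero, LinearEquiv.symm_apply_apply] at h1
  rw [fderiv_fderiv_charPolyCoord_zero, LinearEquiv.symm_apply_apply, LinearEquiv.symm_apply_apply,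
    h1, lsaTraceForm_comm] at h2
  exact ⟨h1, by linarith⟩

/-- At the origin the form is `2 tr R ⊗ tr R - τ`. Evaluating a null vector `y` against `r` gives `2
tr R(y) = tr R(y)`; hence `tr R(y) = 0`, and then `τ(·, y) = 0`. -/
theorem expHessDet_charPolyCoord_ne_zero (hτ : (lsaTraceForm A).Nondegenerate) {r : A}
    (hr : ∀ x, lsaTraceRight A x = lsaTraceForm A r x) (hr1 : lsaTraceRight A r = 1) :
    expHessDet (charPolyCoord b) 0 ≠ 0 := by
  intro h0
  obtain ⟨y, hy0, hy⟩ := Matrix.exists_mulVec_eq_zero_iff.2 h0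
  apply hy0
  have h : ∀ z, expHessForm (charPolyCoord b) 0 z y = 0 := fun z => by
    rw [← LinearMap.BilinForm.toMatrix'.symm_apply_apply (expHessForm (charPolyCoord b) 0),
      LinearMap.BilinForm.toMatrix'_symm, Matrix.toBilin'_apply', hy, dotProduct_zero]
  have h' : ∀ z : A, 2 * (lsaTraceRight A z * lsaTraceRight A (b.equivFun.symm y)) =
      lsaTraceForm A z (b.equivFun.symm y) := fun z => by
    have := h (b.equivFun z)
    rw [expHessForm_apply, fderiv_fderiv_charPolyCoord_zero, fderiv_charPolyCoord_zero,
      fderiv_charPolyCoord_zero, LinearEquiv.symm_apply_apply] at this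
    linarith
  have ht : lsaTraceRight A (b.equivFun.symm y) = 0 := by
    have := h' r
    rw [← hr, hr1] at this
    linarith
  have : b.equivFun.symm y = 0 := hτ.2 _ fun z => by rw [← h', ht]; ring
  exact b.equivFun.symm.map_eq_zero_iff.1 this

end LSA

/-! ### Level sets as hypersurfaces transverse to a fixed direction -/

section LevelSet

variable {E : Type*} [NormedAddCommGroup E] [NormedSpace ℝ E] {f : E → ℝ} {v : E} {α : ℝ}

theorem mem_tangentVectors_levelSet (hf : ContDiff ℝ ω f) (hα : α ≠ 0)
    (hv : ∀ (x : E) (s : ℝ), f (x + s • v) = f x + α * s) {s : ℝ} {p : E} (hp : f p = s) {X : E} :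
    X ∈ tangentVectors {x | f x = s} p ↔ fderiv ℝ f p X = 0 := by
  have hd : HasFDerivAt f (fderiv ℝ f p) p := (hf.differentiable (by simp) p).hasFDerivAt
  constructor
  · rintro ⟨γ, hγ, h0, hM, rfl⟩
    have h1 : HasDerivAt γ (deriv γ 0) 0 := (hγ.differentiableAt (by simp)).hasDerivAt
    have h2 : HasDerivAt (fun t => f (γ t)) (fderiv ℝ f p (deriv γ 0)) 0 :=
      (h0 ▸ hd : HasFDerivAt f (fderiv ℝ f p) (γ 0)).comp_hasDerivAt 0 h1
    have h3 : HasDerivAt (fun t => f (γ t)) 0 0 :=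
      (hasDerivAt_const (0 : ℝ) s).congr_of_eventuallyEq hM
    exact h2.unique h3
  · intro hX
    have hline : HasDerivAt (fun t : ℝ => p + t • X) X 0 := by
      simpa using ((hasDerivAt_id (0 : ℝ)).smul_const X).const_add p
    -- The line `p + tX` is pushed back onto the level set along `v`; the correction has zero
    -- velocity at `t = 0` because `df(X) = 0`.
    refine ⟨fun t => p + t • X + ((s - f (p + t • X)) / α) • v, ?_, by simp [hp], ?_, ?_⟩
    · have hl : ContDiff ℝ ω fun t : ℝ => p + t • X :=
        contDiff_const.add (contDiff_id.smul contDiff_const)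
      exact ((hl.add (((contDiff_const.sub (hf.comp hl)).div_const α).smul
        contDiff_const)).of_le le_top).contDiffAt
    · refine Filter.Eventually.of_forall fun t => ?_
      change f _ = s
      rw [hv]
      field_simp
      ring
    · have hfl : HasDerivAt (fun t : ℝ => f (p + t • X)) 0 0 := by
        have hd' : HasFDerivAt f (fderiv ℝ f p) (p + (0 : ℝ) • X) := by simpa using hd
        have := hd'.comp_hasDerivAt 0 hline
        rwa [hX] at this
      simpa using (hline.fun_add (((hfl.const_sub s).div_const α).smul_const v)).deriv

theorem isSmoothHypersurface_levelSet (hf : ContDiff ℝ ω f) (hα : α ≠ 0)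
    (hv : ∀ (x : E) (s : ℝ), f (x + s • v) = f x + α * s) (s : ℝ) :
    IsSmoothHypersurface {x | f x = s} := by
  intro p _
  refine ⟨Set.univ, fun x => f x - s, isOpen_univ, trivial,
    ((hf.of_le le_top).sub contDiff_const).contDiffOn, fun h => ?_, ?_⟩
  · rw [fderiv_sub_const] at h
    exact hα (by rw [← fderiv_apply_of_translation hf hv p, h]; rfl)
  · ext x
    simp [sub_eq_zero]

theorem isConnected_levelSet (hf : Continuous f) (hα : α ≠ 0)
    (hv : ∀ (x : E) (s : ℝ), f (x + s • v) = f x + α * s) (s : ℝ) :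
    IsConnected {x | f x = s} := by
  have h : {x | f x = s} = Set.range fun x => x + ((s - f x) / α) • v := by
    ext x
    constructor
    · rintro rfl
      exact ⟨x, by simp⟩
    · rintro ⟨y, rfl⟩
      change f _ = s
      rw [hv]
      field_simp
      ring
  rw [h]
  exact isConnected_range (by fun_prop)

/-- Differentiating `df(Y) = 0` along the hypersurface gives `df(D_X Y) = -D²f(X, Y)`, while `df(cv)
= cα`; this determines `h`. A constant transversal has zero derivative. -/
theorem isInducedBy_levelSet (hf : ContDiff ℝ ω f) (hα : α ≠ 0)
    (hv : ∀ (x : E) (s : ℝ), f (x + s • v) = f x + α * s) (s : ℝ) {c : ℝ} (hc : c ≠ 0) :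
    IsInducedBy {x | f x = s} (fun _ => c • v)
      (fun p X Y => -(c * α)⁻¹ * fderiv ℝ (fderiv ℝ f) p X Y) (fun _ _ => 0) (fun _ _ => 0) where
  gauss p hp X hX Y hY hYM := by
    rw [mem_tangentVectors_levelSet hf hα hv hp]
    obtain ⟨γ, hγ, h0, hM, rfl⟩ := hX
    have h1 : HasDerivAt γ (deriv γ 0) 0 := (hγ.differentiableAt (by simp)).hasDerivAt
    have hdf : HasFDerivAt (fderiv ℝ f) (fderiv ℝ (fderiv ℝ f) p) (γ 0) := by
      rw [h0]
      exact ((hf.fderiv_right (m := ω) (by simp)).differentiable (by simp) p).hasFDerivAt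
    have hdY : HasFDerivAt Y (fderiv ℝ Y p) (γ 0) := by
      rw [h0]
      exact (hY.differentiableAt (by simp)).hasFDerivAt
    have h2 : HasDerivAt (fun t => fderiv ℝ f (γ t) (Y (γ t)))
        (fderiv ℝ (fderiv ℝ f) p (deriv γ 0) (Y (γ 0)) +
          fderiv ℝ f (γ 0) (fderiv ℝ Y p (deriv γ 0))) 0 :=
      (hdf.comp_hasDerivAt 0 h1).clm_apply (hdY.comp_hasDerivAt 0 h1)
    have hlim : Filter.Tendsto γ (𝓝 0) (𝓝[{x | f x = s}] p) :=
      tendsto_nhdsWithin_iff.2 ⟨h0 ▸ h1.continuousAt, hM⟩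
    have h3 : (fun t => fderiv ℝ f (γ t) (Y (γ t))) =ᶠ[𝓝 0] fun _ => (0 : ℝ) := by
      filter_upwards [hlim.eventually hYM, hM] with t ht ht'
      exact (mem_tangentVectors_levelSet hf hα hv ht').1 ht
    have h4 := h2.unique ((hasDerivAt_const (0 : ℝ) (0 : ℝ)).congr_of_eventuallyEq h3)
    rw [h0] at h4
    rw [map_sub, map_smul, map_smul, fderiv_apply_of_translation hf hv, smul_eq_mul, smul_eq_mul]
    field_simp
    linarith
  shape_tangent p hp X hX := by
    rw [mem_tangentVectors_levelSet hf hα hv hp, map_zero]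
  weingarten p hp X hX := by simp

end LevelSet

/-! ### Nondegeneracy and the equiaffine normalization -/

section Equiaffine

variable {n : ℕ} {f : (Fin n → ℝ) → ℝ} {v : Fin n → ℝ} {α κ : ℝ}

theorem isNondegenerateOn_levelSet (hf : ContDiff ℝ ω f) (hα : α ≠ 0)
    (hv : ∀ (x : Fin n → ℝ) (s : ℝ), f (x + s • v) = f x + α * s)
    (hdet : ∀ x, expHessDet f x ≠ 0) (s : ℝ) {k : ℝ} (hk : k ≠ 0) :
    IsNondegenerateOn {x | f x = s} (fun p X Y => k * fderiv ℝ (fderiv ℝ f) p X Y) := by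
  intro p hp X hX h
  by_contra hX0
  refine hdet p (Matrix.exists_vecMul_eq_zero_iff.1 ⟨X, hX0, ?_⟩)
  rw [mem_tangentVectors_levelSet hf hα hv hp] at hX
  have key : ∀ Y, expHessForm f p X Y = 0 := fun Y => by
    -- Projecting `Y` along `v` to the tangent space does not change `D²f(X, Y)`, since `v` is in
    -- the kernel of `D²f`.
    have hY := h (Y - (fderiv ℝ f p Y / α) • v) (by
      rw [mem_tangentVectors_levelSet hf hα hv hp, map_sub, map_smul,
        fderiv_apply_of_translation hf hv, smul_eq_mul, div_mul_cancel₀ _ hα, sub_self])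
    dsimp only at hY
    rw [map_sub, map_smul, fderiv_fderiv_apply_of_translation hf hv, smul_zero, sub_zero] at hY
    rw [expHessForm_apply, hX, (mul_eq_zero.1 hY).resolve_left hk]
    ring
  ext j
  have hj := key (Pi.single j 1)
  rw [← LinearMap.BilinForm.toMatrix'.symm_apply_apply (expHessForm f p),
    LinearMap.BilinForm.toMatrix'_symm, Matrix.toBilin'_apply', Matrix.dotProduct_mulVec] at hj
  simpa using hj

/-- The Gram determinant of `D²f + df ⊗ df` on the vectors `X i` is computed twice: as `Ψ(X)² κ` by
change of basis, and as `(cα)²(-cα)^(n-1) det h` by splitting off the slot of `cv`. -/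
theorem isVolumeNormalized_levelSet (hf : ContDiff ℝ ω f) (hα : α ≠ 0)
    (hv : ∀ (x : Fin n → ℝ) (s : ℝ), f (x + s • v) = f x + α * s) (hκ : κ ≠ 0)
    (hdet : ∀ x, expHessDet f x = κ) (s : ℝ) {c : ℝ} (hc : |c * α| ^ (n + 1) = |κ|) :
    IsVolumeNormalized (Pi.basisFun ℝ (Fin n)).det {x | f x = s} (fun _ => c • v)
      (fun p X Y => -(c * α)⁻¹ * fderiv ℝ (fderiv ℝ f) p X Y) := by
  intro p hp i₀ X hX₀ hX
  have hcα : c * α ≠ 0 := by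
    intro h
    rw [h, abs_zero, zero_pow (by simp)] at hc
    exact hκ (abs_eq_zero.1 hc.symm)
  set H : Matrix {i // i ≠ i₀} {i // i ≠ i₀} ℝ :=
    Matrix.of fun i j => -(c * α)⁻¹ * fderiv ℝ (fderiv ℝ f) p (X i) (X j) with hH
  have hX' : ∀ i, i ≠ i₀ → fderiv ℝ f p (X i) = 0 := fun i hi =>
    (mem_tangentVectors_levelSet hf hα hv hp).1 (hX i hi)
  set Q : Matrix (Fin n) (Fin n) ℝ := Matrix.of fun i j => expHessForm f p (X i) (X j) with hQ
  have hQ1 : Q.det = (Pi.basisFun ℝ (Fin n)).det X ^ 2 * κ := by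
    have : Q = Matrix.of X * (expHessForm f p).toMatrix' * (Matrix.of X).transpose := by
      ext i j
      rw [hQ, Matrix.of_apply,
        ← LinearMap.BilinForm.toMatrix'.symm_apply_apply (expHessForm f p),
        LinearMap.BilinForm.toMatrix'_symm, Matrix.toBilin'_apply', Matrix.dotProduct_mulVec]
      simp only [Matrix.mul_apply, dotProduct, Matrix.vecMul, Matrix.transpose_apply,
        Matrix.of_apply, LinearMap.BilinForm.toMatrix'_toBilin']
    have hΨ : (Pi.basisFun ℝ (Fin n)).det X = (Matrix.of X).det := by
      rw [Pi.basisFun_det_apply]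
    rw [this, Matrix.det_mul, Matrix.det_mul, Matrix.det_transpose, hΨ, ← hdet p, expHessDet]
    ring
  have hQ0 : ∀ j, j ≠ i₀ → Q j i₀ = 0 := fun j hj => by
    rw [hQ, Matrix.of_apply, hX₀, map_smul, expHessForm_apply_of_translation hf hv, hX' j hj]
    simp
  have hQ00 : Q i₀ i₀ = (c * α) ^ 2 := by
    rw [hQ, Matrix.of_apply, hX₀, map_smul, expHessForm_apply_of_translation hf hv, map_smul,
      fderiv_apply_of_translation hf hv]
    simp only [smul_eq_mul]
    ring
  have hQ2 : Q.det = (c * α) ^ 2 * ((-(c * α)) ^ (n - 1) * H.det) := by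
    -- On tangent vectors `df` vanishes, so only `D²f = -(cα)h` remains.
    have hb : Q.toSquareBlockProp (fun i => ¬ i = i₀) = (-(c * α)) • H := by
      ext i j
      simp only [Matrix.toSquareBlockProp_def, Matrix.of_apply, Matrix.smul_apply, hQ, hH,
        expHessForm_apply, hX' i i.2, smul_eq_mul]
      rw [zero_mul, add_zero, ← mul_assoc, neg_mul_neg, mul_inv_cancel₀ hcα, one_mul]
    have hu : (Q.toSquareBlockProp (fun i => i = i₀)).det = (c * α) ^ 2 := by
      rw [Matrix.det_unique, ← hQ00]
      rfl
    have hcard : Fintype.card {i : Fin n // ¬ i = i₀} = n - 1 := by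
      rw [Fintype.card_subtype_compl, Fintype.card_fin, Fintype.card_subtype_eq]
    have hd : (Q.toSquareBlockProp (fun i => ¬ i = i₀)).det = (-(c * α)) ^ (n - 1) * H.det := by
      rw [hb, Matrix.det_smul, hcard]
    rw [Matrix.twoBlockTriangular_det Q (fun i => i = i₀) (fun i hi j hj => hj ▸ hQ0 i hi)]
    convert congrArg₂ (· * ·) hu hd
  -- The existence of the slot `i₀` forces `n ≥ 1`, so the truncated `n - 1` satisfies `2 + (n - 1)
  -- = n + 1`.
  have hn := i₀.pos
  have habs := congrArg abs (hQ1.symm.trans hQ2)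
  rw [abs_mul, abs_mul, abs_mul, abs_pow (c * α), abs_pow (-(c * α)), abs_neg, ← mul_assoc,
    ← pow_add, show 2 + (n - 1) = n + 1 by omega, hc,
    abs_of_nonneg (sq_nonneg ((Pi.basisFun ℝ (Fin n)).det X)), mul_comm] at habs
  exact mul_left_cancel₀ (abs_ne_zero.2 hκ) habs

/-- A level set of a function that a one-parameter group of translations shifts, and for which
`det (D²f + df ⊗ df)` is a nonzero constant, is an improper affine sphere. -/
theorem isImproperAffineSphere_levelSet (hf : ContDiff ℝ ω f) (hα : α ≠ 0)
    (hv : ∀ (x : Fin n → ℝ) (s : ℝ), f (x + s • v) = f x + α * s) (hκ : κ ≠ 0)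
    (hdet : ∀ x, expHessDet f x = κ) (s : ℝ) :
    IsImproperAffineSphere (Pi.basisFun ℝ (Fin n)).det {x | f x = s} ∧
      ∃ c : ℝ, c ≠ 0 ∧
        IsEquiaffineNormal (Pi.basisFun ℝ (Fin n)).det {x | f x = s} (fun _ => c • v) := by
  obtain ⟨c, hc⟩ : ∃ c : ℝ, |c * α| ^ (n + 1) = |κ| := by
    -- The normalization fixes only `|cα|`; here `cα` is the nonnegative `(n+1)`-th root of `|κ|`.
    refine ⟨|κ| ^ ((n + 1 : ℕ) : ℝ)⁻¹ / α, ?_⟩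
    rw [div_mul_cancel₀ _ hα, abs_of_nonneg (by positivity),
      Real.rpow_inv_natCast_pow (abs_nonneg κ) (by simp)]
  have hc0 : c ≠ 0 := by
    rintro rfl
    rw [zero_mul, abs_zero, zero_pow (by simp)] at hc
    exact hκ (abs_eq_zero.1 hc.symm)
  have key : IsEquiaffineNormalWith (Pi.basisFun ℝ (Fin n)).det {x | f x = s} (fun _ => c • v)
      (fun p X Y => -(c * α)⁻¹ * fderiv ℝ (fderiv ℝ f) p X Y) (fun _ _ => 0) :=
    { transversal := by
        refine ⟨⟨Set.univ, isOpen_univ, Set.subset_univ _, contDiffOn_const⟩, fun p hp h => ?_⟩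
        rw [mem_tangentVectors_levelSet hf hα hv hp, map_smul, fderiv_apply_of_translation hf hv,
          smul_eq_mul] at h
        exact mul_ne_zero hc0 hα h
      induced := isInducedBy_levelSet hf hα hv s hc0
      nondegenerate := isNondegenerateOn_levelSet hf hα hv (fun x => by rwa [hdet]) s
        (neg_ne_zero.2 (inv_ne_zero (mul_ne_zero hc0 hα)))
      volume := isVolumeNormalized_levelSet hf hα hv hκ hdet s hc }
  exact ⟨⟨isSmoothHypersurface_levelSet hf hα hv s, isConnected_levelSet hf.continuous hα hv s,
    _, _, _, key, fun p hp X hX => (zero_smul ℝ X).symm⟩, c, hc0, _, _, key⟩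

end Equiaffine

end

/-- `b` is any basis of the algebra `A`; it provides equiaffine coordinates `Fin n → ℝ` on `A` for
the parallel volume form that is `1` on `b`, and every parallel volume form arises in this way. -/
theorem mainTheorem5 {A : Type*} [LeftPreLieRing A] [LeftPreLieAlgebra ℝ A] {n : ℕ}
    (b : Module.Basis (Fin n) ℝ A) (v : A) (hv : v ≠ 0) (α : ℝ)
    (hP : ∀ (x : A) (t : ℝ), lsaCharPoly A (x + t • v) = lsaCharPoly A x + α * t)
    (hLR : ∀ x : A, 2 * lsaTraceLeft A x = ((n : ℝ) + 1) * lsaTraceRight A x) :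
    ∃ κ : ℝ,
      (∀ x : Fin n → ℝ,
        hessianDet (fun y => Real.exp (lsaCharPoly A (b.equivFun.symm y))) x =
          κ * Real.exp (n * lsaCharPoly A (b.equivFun.symm x))) ∧
      ((lsaTraceForm A).Nondegenerate →
        κ ≠ 0 ∧
        (∀ s : ℝ,
          IsImproperAffineSphere (Pi.basisFun ℝ (Fin n)).det
            {x : Fin n → ℝ | lsaCharPoly A (b.equivFun.symm x) = s} ∧
          ∃ c : ℝ, c ≠ 0 ∧
            IsEquiaffineNormal (Pi.basisFun ℝ (Fin n)).det
              {x : Fin n → ℝ | lsaCharPoly A (b.equivFun.symm x) = s}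
              (fun _ => c • b.equivFun v)) ∧
        α ≠ 0 ∧
        IsRightPrincipalIdempotent A (α⁻¹ • v) ∧
        lsaTraceRight A (α⁻¹ • v) = 1) := by
  have hf := contDiff_charPolyCoord b
  have hconst := expHessDet_charPolyCoord b hv hP hLR
  refine ⟨expHessDet (charPolyCoord b) 0, fun x => ?_, fun hτ => ?_⟩
  · rw [← hconst x]
    exact hessianDet_exp hf x
  have hv' : ∀ (x : Fin n → ℝ) (s : ℝ),
      charPolyCoord b (x + s • b.equivFun v) = charPolyCoord b x + α * s :=
    fun x s => by simp [charPolyCoord, map_add, hP]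
  have hα : α ≠ 0 := by
    rintro rfl
    -- Since `τ(v, x) = α tr R(x)`, the case `α = 0` would put `v ≠ 0` in the radical of `τ`.
    exact hv (hτ.1 v fun x => by rw [(lsaTraceForm_apply_of_translation b hP x).2, zero_mul])
  have hr : ∀ x, lsaTraceRight A x = lsaTraceForm A (α⁻¹ • v) x := fun x => by
    rw [map_smul, LinearMap.smul_apply, (lsaTraceForm_apply_of_translation b hP x).2, smul_eq_mul,
      inv_mul_cancel_left₀ hα]
  have hr1 : lsaTraceRight A (α⁻¹ • v) = 1 := by
    rw [map_smul, (lsaTraceForm_apply_of_translation b hP 0).1, smul_eq_mul, inv_mul_cancel₀ hα]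
  have hκ := expHessDet_charPolyCoord_ne_zero b hτ hr hr1
  exact ⟨hκ, isImproperAffineSphere_levelSet hf hα hv' hκ hconst, hα,
    isRightPrincipalIdempotent_of_traceForm hτ hr, hr1⟩
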